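/- **Theorem 3.4.** All graphs are finite simple graphs. The subdivision graph $S(G)$ of $G$ is obtained by inserting a new vertex into every edge of $G$; let $I(G)$ be the set of new vertices. For graphs $G_1,G_2$ let $G_1\dot\vee G_2$ (respectively $G_1\veebar G_2$) be the graph obtained from the disjoint union of $S(G_1)$ and $G_2$ by joining each vertex of $V(G_1)$ (respectively of $I(G_1)$) with every vertex of $V(G_2)$. The normalized Laplacian of a graph with adjacency matrix $A$ and degree matrix $D$ is $D^{-1/2}(D-A)D^{-1/2}$ (which equals $I-D^{-1/2}AD^{-1/2}$ if there are no isolated vertices), with the convention that the diagonal entry of $D^{-1/2}$ at an isolated vertex is $0$; its spectrum is the multiset of its eigenvalues. Let $t(G)$ denote the number of spanning trees of $G$. Let $G_1$ be an $r_1$-regular graph on $n_1\ge 1$ vertices and $m_1$ edges, and let $G_2$ be an $r_2$-regular graph on $n_2\ge 1$ vertices. Let $0=\mu_1,\mu_2,\dots,\mu_{n_1}$ and $0=\nu_1,\nu_2,\dots,\nu_{n_2}$ be the normalized Laplacian spectra of $G_1$ and $G_2$, respectively. Then $$t(G_1\dot\vee G_2)=2^{m_1-n_1+1}\prod_{i=2}^{n_1}(2n_2+r_1\mu_i)\prod_{j=2}^{n_2}(n_1+r_2\nu_j)$$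 and $$t(G_1\veebar G_2)=r_1^{n_1}(2+n_2)^{m_1-n_1}\prod_{i=2}^{n_1}(n_2+\mu_i)\prod_{j=2}^{n_2}(m_1+r_2\nu_j),$$ where the exponents $m_1-n_1+1$ and $m_1-n_1$ are integers, possibly negative. -/

import Mathlib

namespace SubdivJoin

/-- The subdivision graph `S(G)`: its vertices are the vertices of `G` together with one new vertex
for each edge of `G`, and the new vertex of an edge is adjacent exactly to the two ends of it. -/
def subdivision {V : Type*} (G : SimpleGraph V) : SimpleGraph (V ⊕ G.edgeSet) where
  Adj x y :=
    match x, y with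
    | Sum.inl v, Sum.inr e => v ∈ (e : Sym2 V)
    | Sum.inr e, Sum.inl v => v ∈ (e : Sym2 V)
    | _, _ => False
  symm := ⟨by rintro (v | e) (w | f) h <;> exact h⟩
  loopless := ⟨by rintro (v | e) h <;> exact h⟩

/-- The graph obtained from the disjoint union of `H` and `K` by joining each vertex in `S` with
every vertex of `K`. -/
def joinAlong {α β : Type*} (H : SimpleGraph α) (S : Set α) (K : SimpleGraph β) :
    SimpleGraph (α ⊕ β) where
  Adj x y :=
    match x, y with
    | Sum.inl a, Sum.inl a' => H.Adj a a'
    | Sum.inr b, Sum.inr b' => K.Adj b b'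
    | Sum.inl a, Sum.inr _ => a ∈ S
    | Sum.inr _, Sum.inl a => a ∈ S
  symm := ⟨by
    rintro (a | b) (a' | b') h
    · exact SimpleGraph.Adj.symm h
    · exact h
    · exact h
    · exact SimpleGraph.Adj.symm h⟩
  loopless := ⟨by
    rintro (a | b) h
    · exact H.irrefl h
    · exact K.irrefl h⟩

/-- The subdivision-vertex join: the original vertices of `S(G₁)` are joined with those of `G₂`. -/
def vertexJoin {V₁ V₂ : Type*} (G₁ : SimpleGraph V₁) (G₂ : SimpleGraph V₂) :
    SimpleGraph ((V₁ ⊕ G₁.edgeSet) ⊕ V₂) :=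
  joinAlong (subdivision G₁) (Set.range Sum.inl) G₂

/-- The subdivision-edge join: the new vertices of `S(G₁)` are joined with those of `G₂`. -/
def edgeJoin {V₁ V₂ : Type*} (G₁ : SimpleGraph V₁) (G₂ : SimpleGraph V₂) :
    SimpleGraph ((V₁ ⊕ G₁.edgeSet) ⊕ V₂) :=
  joinAlong (subdivision G₁) (Set.range Sum.inr) G₂

/-- The number of spanning trees of `G`: subgraphs on all the vertices of `G` that are trees. -/
noncomputable def numSpanningTrees {V : Type*} (G : SimpleGraph V) : ℕ :=
  {T : SimpleGraph V | T ≤ G ∧ T.IsTree}.ncard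

/-- The matrix `D(G)^{-1/2}`, where the entry of an isolated vertex is `0`. -/
noncomputable def invSqrtDegMatrix {V : Type*} [Fintype V] [DecidableEq V] (G : SimpleGraph V)
    [DecidableRel G.Adj] : Matrix V V ℝ :=
  Matrix.diagonal fun v => (√(G.degree v : ℝ))⁻¹

/-- The normalized Laplacian matrix `D^{-1/2} (D - A) D^{-1/2}`. It is `I - D^{-1/2} A D^{-1/2}`
when there are no isolated vertices (see `normalizedLaplacian_eq`); with the usual convention
`D^{-1/2}(v, v) = 0` at an isolated vertex `v`, the row and the column of `v` are zero. -/
noncomputable def normalizedLaplacian {V : Type*} [Fintype V] [DecidableEq V] (G : SimpleGraph V)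
    [DecidableRel G.Adj] : Matrix V V ℝ :=
  invSqrtDegMatrix G * (G.degMatrix ℝ - G.adjMatrix ℝ) * invSqrtDegMatrix G

theorem normalizedLaplacian_eq {V : Type*} [Fintype V] [DecidableEq V] (G : SimpleGraph V)
    [DecidableRel G.Adj] (h : ∀ v, 0 < G.degree v) :
    normalizedLaplacian G = 1 - invSqrtDegMatrix G * G.adjMatrix ℝ * invSqrtDegMatrix G := by
  have h1 : invSqrtDegMatrix G * G.degMatrix ℝ * invSqrtDegMatrix G = 1 := by
    unfold invSqrtDegMatrix SimpleGraph.degMatrix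
    rw [Matrix.diagonal_mul_diagonal, Matrix.diagonal_mul_diagonal, ← Matrix.diagonal_one]
    congr 1
    funext v
    have hv : (0 : ℝ) < G.degree v := by exact_mod_cast h v
    have hs : √(G.degree v : ℝ) ≠ 0 := (Real.sqrt_pos.mpr hv).ne'
    have hq := Real.mul_self_sqrt hv.le
    field_simp
    nlinarith
  rw [normalizedLaplacian, mul_sub, sub_mul, h1]

/-- The normalized Laplacian spectrum: the roots, with multiplicity, of the characteristic
polynomial of the normalized Laplacian matrix. -/
noncomputable def normalizedLaplacianSpectrum {V : Type*} [Fintype V] [DecidableEq V]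
    (G : SimpleGraph V) [DecidableRel G.Adj] : Multiset ℝ :=
  (normalizedLaplacian G).charpoly.roots

end SubdivJoin

/-!
The proof evaluates one determinant in two ways.

The matrix tree theorem is proved by expanding the determinant of the Laplacian, with the row of a
root `r` replaced by `e_r`, along its rows: the row of `v` is the sum of `e_v - e_u` over the
neighbours `u` of `v`, so the determinant is a sum over functions `f` that send each vertex `v ≠ r`
to a neighbour. The matrix with rows `e_v - e_{f v}` is unitriangular if iterating `f` leads from
every vertex to `r`, and it kills the indicator of the vertices that never reach `r` otherwise; and
the functions of the first kind are the parent maps of the spanning trees rooted at `r`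
(`numSpanningTrees_eq_ncard_parentMaps`, `det_updateRow_lapMatrix`). Since the rows and columns of
the Laplacian `L` sum to zero, it follows that `det (L + x yᵀ) = (∑ x) (∑ y) t(G)`
(`det_lapMatrix_add_vecMulVec`).

Now join `H` along a set `S` of vertices with `K`, and take for `x` the indicator of `S ∪ V(K)` and
for `y` that of `V(K)`. Then `L + x yᵀ` is block triangular, which separates the two graphs
(`numSpanningTrees_joinAlong`). The block of `K` is `|S| + L(K) + J`, with `J` the all-ones matrix,
whose determinant is read off the spectrum of `K`. In both joins the block of `S(G₁)` has scalar
diagonal blocks on the old and on the new vertices, and minus the incidence matrix `B` off the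
diagonal; as `B Bᵀ = 2 r₁ - L(G₁)`, its Schur complement is a multiple of a scalar plus `L(G₁)`
(`det_fromBlocks_edgeIncMatrix`). For an `r`-regular graph `L` is `r` times the normalized
Laplacian, also for `r = 0`.
-/

namespace SubdivJoin

open Matrix Finset

/-! ### Spanning trees as parent maps -/

section ParentMaps

variable {V : Type*}

/-- `f` sends every vertex to its parent in a spanning tree of `G` rooted at `r`: every vertex other
than `r` is adjacent in `G` to its image, and iterating `f` leads from every vertex to `r`. The root
is its own parent. -/
def IsParentMap (G : SimpleGraph V) (r : V) (f : V → V) : Prop :=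
  f r = r ∧ (∀ v, v ≠ r → G.Adj v (f v)) ∧ ∀ v, ∃ k, f^[k] v = r

/-- The graph whose edges are the pairs `{v, f v}` with `f v ≠ v`. -/
def functionGraph (f : V → V) : SimpleGraph V :=
  SimpleGraph.fromRel fun v w => f v = w

theorem functionGraph_adj {f : V → V} {v w : V} :
    (functionGraph f).Adj v w ↔ v ≠ w ∧ (f v = w ∨ f w = v) := by
  simp [functionGraph]

theorem functionGraph_le {G : SimpleGraph V} {r : V} {f : V → V} (hf : IsParentMap G r f) :
    functionGraph f ≤ G := by
  intro v w h
  obtain ⟨hne, rfl | rfl⟩ := functionGraph_adj.mp h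
  · exact hf.2.1 v fun hv => hne (by rw [hv, hf.1])
  · exact (hf.2.1 w fun hw => hne (by rw [hw, hf.1])).symm

theorem functionGraph_connected {r : V} {f : V → V} (hf : ∀ v, ∃ k, f^[k] v = r) :
    (functionGraph f).Connected := by
  have key : ∀ k v, (functionGraph f).Reachable v (f^[k] v) := by
    intro k
    induction k with
    | zero => intro v; rfl
    | succ k ih =>
      intro v
      rw [Function.iterate_succ_apply]
      refine SimpleGraph.Reachable.trans ?_ (ih (f v))
      by_cases h : v = f v
      · rw [← h]
      · exact (functionGraph_adj.mpr ⟨h, Or.inl rfl⟩).reachable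
  have hr : ∀ v, (functionGraph f).Reachable v r := fun v => by
    obtain ⟨k, hk⟩ := hf v
    exact hk ▸ key k v
  exact { preconnected := fun v w => (hr v).trans (hr w).symm, nonempty := ⟨r⟩ }

theorem functionGraph_isTree [Finite V] {r : V} {f : V → V} (h0 : f r = r)
    (hf : ∀ v, ∃ k, f^[k] v = r) : (functionGraph f).IsTree := by
  classical
  have := Fintype.ofFinite V
  have hc := functionGraph_connected hf
  refine SimpleGraph.isTree_iff_connected_and_card.mpr ⟨hc, le_antisymm ?_ ?_⟩
  · have hsub : (functionGraph f).edgeSet ⊆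
        ((univ.erase r).image fun v => s(v, f v) : Finset (Sym2 V)) := by
      intro e he
      induction e with
      | _ v w =>
        obtain ⟨hne, rfl | rfl⟩ :=
          functionGraph_adj.mp ((functionGraph f).mem_edgeSet.mp he)
        · simp only [coe_image, Set.mem_image, mem_coe, mem_erase, mem_univ, and_true]
          exact ⟨v, fun h => hne (by rw [h, h0]), rfl⟩
        · simp only [coe_image, Set.mem_image, mem_coe, mem_erase, mem_univ, and_true]
          exact ⟨w, fun h => hne (by rw [h, h0]), Sym2.eq_swap⟩
    have h1 : Nat.card (functionGraph f).edgeSet ≤ (univ.erase r).card := by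
      rw [Nat.card_coe_set_eq]
      refine (Set.ncard_le_ncard hsub).trans ?_
      rw [Set.ncard_coe_finset]
      exact card_image_le
    rw [card_erase_of_mem (mem_univ r), card_univ] at h1
    rw [Nat.card_eq_fintype_card (α := V)]
    have : 0 < Fintype.card V := Fintype.card_pos_iff.mpr ⟨r⟩
    omega
  · exact hc.card_vert_le_card_edgeSet_add_one

/-- A rooted tree determines the parent of each vertex. -/
theorem functionGraph_injOn {r : V} {f g : V → V} (hf : f r = r) (hg : g r = r)
    (hf' : ∀ v, v ≠ r → f v ≠ v) (hg' : ∀ v, v ≠ r → g v ≠ v) (hgr : ∀ v, ∃ k, g^[k] v = r)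
    (h : functionGraph f = functionGraph g) : f = g := by
  have key : ∀ k v, g^[k] v = r → f v = g v := by
    intro k
    induction k with
    | zero => rintro v rfl; exact hf.trans hg.symm
    | succ k ih =>
      intro v hk
      rw [Function.iterate_succ_apply] at hk
      have hu := ih (g v) hk
      by_cases hv : v = r
      · rw [hv, hf, hg]
      have hadj : (functionGraph f).Adj v (g v) := by
        rw [h]
        exact functionGraph_adj.mpr ⟨(hg' v hv).symm, Or.inl rfl⟩
      obtain ⟨hne, h1 | h1⟩ := functionGraph_adj.mp hadj
      · exact h1
      · -- Here `g` exchanges `v` and `g v`, so the `g`-orbit of `v` misses `r`.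
        exfalso
        rw [h1] at hu
        have horb : ∀ j, g^[j] v = v ∨ g^[j] v = g v := by
          intro j
          induction j with
          | zero => exact Or.inl rfl
          | succ j ihj =>
            rw [Function.iterate_succ_apply']
            rcases ihj with e | e
            · right; rw [e]
            · left; rw [e, ← hu]
        obtain ⟨j, hj⟩ := hgr v
        rcases horb j with e | e
        · exact hv (e.symm.trans hj)
        · have : g v = r := e.symm.trans hj
          rw [this, hg] at hu
          exact hv hu
  funext v
  obtain ⟨k, hk⟩ := hgr v
  exact key k v hk

theorem exists_parentMap {G T : SimpleGraph V} (hT : T ≤ G) (ht : T.IsTree) (r : V) :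
    ∃ f, IsParentMap G r f ∧ functionGraph f = T := by
  classical
  have hc := ht.connected
  have hex : ∀ v, v ≠ r → ∃ w, T.Adj v w ∧ T.dist w r + 1 = T.dist v r := by
    intro v hv
    obtain ⟨p, hp⟩ := hc.exists_walk_length_eq_dist v r
    cases p with
    | nil => exact absurd rfl hv
    | cons hadj q =>
      refine ⟨_, hadj, ?_⟩
      rw [SimpleGraph.Walk.length_cons] at hp
      have h1 := SimpleGraph.dist_le q
      have h2 := hc.dist_triangle (u := v) (v := _) (w := r) |>.trans
        (Nat.add_le_add_right (SimpleGraph.dist_eq_one_iff_adj.mpr hadj).le _)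
      omega
  choose! p hp using hex
  -- The parent of `v` is a neighbour nearer to the root.
  let f : V → V := fun v => if v = r then r else p v
  have hfr : f r = r := if_pos rfl
  have hfv : ∀ v, v ≠ r → f v = p v := fun v hv => if_neg hv
  have hreach : ∀ n v, T.dist v r = n → ∃ k, f^[k] v = r := by
    intro n
    induction n with
    | zero => intro v hv; exact ⟨0, (hc v r).dist_eq_zero_iff.mp hv⟩
    | succ n ih =>
      intro v hv
      have hvr : v ≠ r := by rintro rfl; simp at hv
      obtain ⟨k, hk⟩ := ih (f v) (by rw [hfv v hvr]; have := (hp v hvr).2; omega)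
      exact ⟨k + 1, by rwa [Function.iterate_succ_apply]⟩
  have hf : IsParentMap T r f :=
    ⟨hfr, fun v hv => by rw [hfv v hv]; exact (hp v hv).1, fun v => hreach _ v rfl⟩
  refine ⟨f, ⟨hf.1, fun v hv => hT (hf.2.1 v hv), hf.2.2⟩, ?_⟩
  exact le_antisymm (functionGraph_le hf) ((SimpleGraph.isTree_iff_minimal_connected.mp ht).2
    (functionGraph_connected hf.2.2) (functionGraph_le hf))

theorem numSpanningTrees_eq_ncard_parentMaps [Finite V] (G : SimpleGraph V) (r : V) :
    numSpanningTrees G = {f | IsParentMap G r f}.ncard := by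
  have himg : {T : SimpleGraph V | T ≤ G ∧ T.IsTree} =
      functionGraph '' {f | IsParentMap G r f} := by
    ext T
    constructor
    · rintro ⟨hT, ht⟩
      exact exists_parentMap hT ht r
    · rintro ⟨f, hf, rfl⟩
      exact ⟨functionGraph_le hf, functionGraph_isTree hf.1 hf.2.2⟩
  rw [numSpanningTrees, himg, Set.InjOn.ncard_image]
  intro f hf g hg h
  exact functionGraph_injOn hf.1 hg.1 (fun v hv => (hf.2.1 v hv).ne') (fun v hv => (hg.2.1 v hv).ne')
    hg.2.2 h

end ParentMaps

/-! ### The matrix tree theorem -/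

section MatrixTree

variable {V : Type*} [Fintype V] [DecidableEq V]

/-- The matrix whose row at `v` is `e_v - e_{f v}` if `v ≠ r` and `e_r` if `v = r`. -/
def parentMatrix (r : V) (f : V → V) : Matrix V V ℝ :=
  Matrix.of fun v => (Pi.single v 1 - if v = r then 0 else Pi.single (f v) 1 : V → ℝ)

theorem det_parentMatrix_of_reach {r : V} {f : V → V} (hf : ∀ v, ∃ k, f^[k] v = r) :
    (parentMatrix r f).det = 1 := by
  have hlt : ∀ v, v ≠ r → Nat.find (hf (f v)) < Nat.find (hf v) := by
    intro v hv
    have h1 := Nat.find_spec (hf v)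
    obtain ⟨k, hk⟩ : ∃ k, Nat.find (hf v) = k + 1 := by
      refine Nat.exists_eq_succ_of_ne_zero fun h0 => hv ?_
      rwa [h0] at h1
    rw [hk] at h1 ⊢
    exact Nat.lt_succ_of_le (Nat.find_min' _ (by rwa [Function.iterate_succ_apply] at h1))
  have hoff : ∀ v u, v ≠ u → ¬ Nat.find (hf u) < Nat.find (hf v) → parentMatrix r f v u = 0 := by
    intro v u hne hnlt
    rw [parentMatrix, Matrix.of_apply, Pi.sub_apply, Pi.single_eq_of_ne hne.symm]
    split_ifs with hv
    · simp
    · rw [Pi.single_eq_of_ne, sub_zero]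
      rintro rfl
      exact hnlt (hlt v hv)
  have hdiag : ∀ v, parentMatrix r f v v = 1 := by
    intro v
    rw [parentMatrix, Matrix.of_apply, Pi.sub_apply, Pi.single_eq_same]
    split_ifs with hv
    · simp
    · rw [Pi.single_eq_of_ne, sub_zero]
      intro h
      have := hlt v hv
      rw [← h] at this
      exact this.false
  -- Ordering the vertices by decreasing distance to the root makes the matrix unitriangular.
  have htri : (parentMatrix r f).BlockTriangular fun v => OrderDual.toDual (Nat.find (hf v)) := by
    intro v u h
    have h' : Nat.find (hf v) < Nat.find (hf u) := h
    exact hoff v u (by rintro rfl; exact h'.false) h'.le.not_gt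
  rw [htri.det]
  refine prod_eq_one fun a _ => ?_
  suffices h1 : (parentMatrix r f).toSquareBlock
      (fun v => OrderDual.toDual (Nat.find (hf v))) a = 1 by rw [h1, det_one]
  ext ⟨v, hv⟩ ⟨u, hu⟩
  rw [toSquareBlock_def, Matrix.of_apply]
  by_cases h : v = u
  · subst h
    rw [hdiag, one_apply_eq]
  · rw [one_apply_ne fun h' => h (congrArg Subtype.val h')]
    refine hoff v u h ?_
    have : Nat.find (hf u) = Nat.find (hf v) := OrderDual.toDual.injective (hu.trans hv.symm)
    rw [this]
    exact lt_irrefl _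

theorem det_parentMatrix_of_not_reach {r : V} {f : V → V} (hf : ¬ ∀ v, ∃ k, f^[k] v = r) :
    (parentMatrix r f).det = 0 := by
  classical
  -- The indicator of the vertices that never reach `r` lies in the kernel.
  obtain ⟨v₀, hv₀⟩ := not_forall.mp hf
  refine exists_mulVec_eq_zero_iff.mp ⟨fun v => if ∃ k, f^[k] v = r then 0 else 1, ?_, ?_⟩
  · intro h
    have := congrFun h v₀
    simp only [if_neg hv₀, Pi.zero_apply, one_ne_zero] at this
  · ext v
    rw [mulVec, parentMatrix, Pi.zero_apply]
    change (Pi.single v 1 - if v = r then 0 else Pi.single (f v) 1 : V → ℝ) ⬝ᵥ _ = _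
    rw [sub_dotProduct, single_dotProduct, one_mul]
    split_ifs with h1 h2 h2
    · simp
    · rw [single_dotProduct, one_mul, if_pos, sub_zero]
      obtain ⟨k, hk⟩ := h1
      cases k with
      | zero => exact absurd hk h2
      | succ k => exact ⟨k, hk⟩
    · exact absurd ⟨0, h2⟩ h1
    · rw [single_dotProduct, one_mul, if_neg, sub_self]
      rintro ⟨k, hk⟩
      exact h1 ⟨k + 1, hk⟩

/-- The **matrix tree theorem**: replacing the row of the Laplacian at `r` by `e_r` gives a matrix
whose determinant, a principal minor of the Laplacian, is the number of spanning trees. -/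
theorem det_updateRow_lapMatrix (G : SimpleGraph V) [DecidableRel G.Adj] (r : V) :
    ((G.lapMatrix ℝ).updateRow r (Pi.single r 1)).det = numSpanningTrees G := by
  classical
  let c : V → V → ℝ := fun v u =>
    if v = r then (if u = r then 1 else 0) else if G.Adj v u then 1 else 0
  have hrow : (G.lapMatrix ℝ).updateRow r (Pi.single r 1) =
      fun v => ∑ u, c v u • (Pi.single v 1 - if v = r then 0 else Pi.single u 1 : V → ℝ) := by
    funext v
    by_cases hv : v = r
    · subst hv
      rw [updateRow_self]
      simp [c]
    · rw [updateRow_ne hv]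
      ext w
      simp only [c, if_neg hv, Finset.sum_apply, Pi.smul_apply, Pi.sub_apply, smul_eq_mul, mul_sub,
        sum_sub_distrib]
      rw [SimpleGraph.lapMatrix, Matrix.sub_apply, SimpleGraph.degMatrix, diagonal_apply,
        SimpleGraph.adjMatrix_apply, ← sum_mul, ← SimpleGraph.degree_eq_sum_if_adj]
      congr 1
      · by_cases hw : v = w
        · subst hw; simp
        · rw [if_neg hw, Pi.single_eq_of_ne (Ne.symm hw), mul_zero]
      · simp [Pi.single_apply]
  have hterm : ∀ f : V → V,
      (∏ v, c v (f v)) * (parentMatrix r f).det = if IsParentMap G r f then 1 else 0 := by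
    intro f
    split_ifs with hf
    · rw [det_parentMatrix_of_reach hf.2.2, mul_one]
      refine prod_eq_one fun v _ => ?_
      by_cases hv : v = r
      · simp [c, hv, hf.1]
      · simp [c, hv, hf.2.1 v hv]
    · by_cases hreach : ∀ v, ∃ k, f^[k] v = r
      · refine mul_eq_zero_of_left ?_ _
        by_contra hne
        rw [← ne_eq, prod_ne_zero_iff] at hne
        refine hf ⟨?_, fun v hv => ?_, hreach⟩
        · have := hne r (mem_univ r)
          by_contra h
          simp [c, h] at this
        · have := hne v (mem_univ v)
          by_contra h
          simp [c, hv, h] at this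
      · rw [det_parentMatrix_of_not_reach hreach, mul_zero]
  calc ((G.lapMatrix ℝ).updateRow r (Pi.single r 1)).det
      = detRowAlternating.toMultilinearMap fun v =>
          ∑ u, c v u • (Pi.single v 1 - if v = r then 0 else Pi.single u 1 : V → ℝ) := by
        rw [hrow]; rfl
    _ = ∑ f : V → V, (∏ v, c v (f v)) * (parentMatrix r f).det := by
        rw [MultilinearMap.map_sum]
        refine sum_congr rfl fun f _ => ?_
        rw [MultilinearMap.map_smul_univ]
        rfl
    _ = numSpanningTrees G := by
        rw [sum_congr rfl fun f _ => hterm f, sum_boole, numSpanningTrees_eq_ncard_parentMaps G r,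
          ← Set.ncard_coe_finset, coe_filter]
        simp

/-- A rank one perturbation of a matrix with zero row and column sums has determinant
`(∑ x) (∑ y)` times a principal minor. -/
theorem det_add_vecMulVec_of_sum_eq_zero {L : Matrix V V ℝ} (hrow : ∀ i, ∑ j, L i j = 0)
    (hcol : ∀ j, ∑ i, L i j = 0) (x y : V → ℝ) (r : V) :
    (L + vecMulVec x y).det = (∑ i, x i) * (∑ j, y j) * (L.updateRow r (Pi.single r 1)).det := by
  have h1 : (L + vecMulVec x y).det = (∑ i, x i) * ((L + vecMulVec x y).updateRow r y).det := by
    -- Replacing row `r` by the sum of all rows turns it into `(∑ x) y`.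
    have h := det_updateRow_sum (L + vecMulVec x y) r fun _ => 1
    rw [one_smul] at h
    rw [← h, ← det_updateRow_smul]
    congr 2
    ext j
    rw [Finset.sum_apply]
    simp [Matrix.add_apply, sum_add_distrib, hcol, vecMulVec_apply, sum_mul]
  -- Multiples of the new row `r` clear the perturbation from the other rows.
  have h2 : ((L + vecMulVec x y).updateRow r y).det = (L.updateRow r y).det := by
    refine det_eq_of_forall_row_eq_smul_add_const (fun i => if i = r then 0 else x i) r
      (if_pos rfl) fun i j => ?_
    by_cases hi : i = r
    · subst hi; simp
    · simp [hi, vecMulVec_apply]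
  have h3 : (L.updateRow r y).det = (∑ j, y j) * (L.updateRow r (Pi.single r 1)).det := by
    have hy : y = (y - (∑ j, y j) • Pi.single r 1) + (∑ j, y j) • Pi.single r 1 := by simp
    -- A row with sum zero makes the constant vector a kernel vector.
    have hz : (L.updateRow r (y - (∑ j, y j) • Pi.single r 1)).det = 0 := by
      refine exists_mulVec_eq_zero_iff.mp ⟨fun _ => 1, ?_, ?_⟩
      · intro h; simpa using congrFun h r
      · ext i
        by_cases hi : i = r
        · subst hi
          simp [mulVec, dotProduct, sum_sub_distrib, ← mul_sum]
        · simp [mulVec, dotProduct, updateRow_ne hi, hrow]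
    conv_lhs => rw [hy]
    rw [det_updateRow_add, hz, zero_add, det_updateRow_smul]
  rw [h1, h2, h3, mul_assoc]

/-- The matrix tree theorem in the form of a rank one perturbation of the Laplacian. -/
theorem det_lapMatrix_add_vecMulVec [Nonempty V] (G : SimpleGraph V) [DecidableRel G.Adj]
    (x y : V → ℝ) :
    (G.lapMatrix ℝ + vecMulVec x y).det = (∑ i, x i) * (∑ j, y j) * numSpanningTrees G := by
  have hrow : ∀ i, ∑ j, G.lapMatrix ℝ i j = 0 := fun i => by
    simpa [mulVec, dotProduct] using congrFun (G.lapMatrix_mulVec_const_eq_zero (R := ℝ)) i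
  obtain ⟨r⟩ := ‹Nonempty V›
  rw [det_add_vecMulVec_of_sum_eq_zero hrow _ x y r, det_updateRow_lapMatrix]
  intro j
  rw [← hrow j]
  exact sum_congr rfl fun i _ => (G.isSymm_lapMatrix (R := ℝ)).apply j i

end MatrixTree

/-! ### Determinants from the normalized Laplacian spectrum -/

section Spectrum

theorem prod_Icc_one_eq {n : ℕ} (hn : 1 ≤ n) (f : ℕ → ℝ) :
    ∏ i ∈ Icc 1 n, f i = f 1 * ∏ i ∈ Icc 2 n, f i := by
  rw [← prod_insert (by simp)]
  congr 1
  ext i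
  simp only [mem_Icc, mem_insert]
  omega

variable {V : Type*} [Fintype V] [DecidableEq V]

/-- As `A` has as many real roots of the characteristic polynomial as rows, the polynomial splits. -/
theorem det_smul_one_add_of_charpoly_roots {A : Matrix V V ℝ} {μ : ℕ → ℝ}
    (hA : A.charpoly.roots = (Icc 1 (Fintype.card V)).val.map μ) (c : ℝ) :
    (c • (1 : Matrix V V ℝ) + A).det = ∏ i ∈ Icc 1 (Fintype.card V), (c + μ i) := by
  have hcard : A.charpoly.roots.card = A.charpoly.natDegree := by
    rw [hA, charpoly_natDegree_eq_dim]
    simp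
  have hprod := Polynomial.prod_multiset_X_sub_C_of_monic_of_roots_card_eq A.charpoly_monic hcard
  have heval := congrArg (Polynomial.eval (-c)) hprod
  rw [hA, Multiset.map_map, eval_charpoly] at heval
  have hneg : c • (1 : Matrix V V ℝ) + A = -(scalar V (-c) - A) := by
    ext i j
    by_cases h : i = j
    · simp [h, add_comm]
    · simp [h]
  have hsign : ∏ i ∈ Icc 1 (Fintype.card V), (c + μ i) =
      (-1) ^ Fintype.card V * ∏ i ∈ Icc 1 (Fintype.card V), (-c - μ i) := by
    have hpow : (-1 : ℝ) ^ Fintype.card V = ∏ _i ∈ Icc 1 (Fintype.card V), (-1 : ℝ) := by simp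
    rw [hpow, ← prod_mul_distrib]
    exact prod_congr rfl fun i _ => by ring
  rw [hneg, det_neg, ← heval, hsign, Polynomial.eval_multiset_prod, Multiset.map_map]
  congr 1
  rw [prod_eq_multiset_prod]
  congr 1
  exact Multiset.map_congr rfl fun i _ => by simp

/-- For `r = 0` both sides vanish. -/
theorem lapMatrix_eq_smul_normalizedLaplacian (G : SimpleGraph V) [DecidableRel G.Adj] {r : ℕ}
    (hr : G.IsRegularOfDegree r) : G.lapMatrix ℝ = (r : ℝ) • normalizedLaplacian G := by
  have hdiag : invSqrtDegMatrix G = (√(r : ℝ))⁻¹ • (1 : Matrix V V ℝ) := by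
    rw [invSqrtDegMatrix, smul_one_eq_diagonal]
    simp only [hr.degree_eq]
  rw [normalizedLaplacian, hdiag, ← SimpleGraph.lapMatrix, smul_mul_assoc, one_mul, mul_smul_comm,
    mul_one, smul_smul, smul_smul]
  rcases Nat.eq_zero_or_pos r with h0 | h0
  · have hz : G.lapMatrix ℝ = 0 := by
      ext v w
      have hv : ∀ u, ¬ G.Adj v u := by
        have := hr v
        rw [h0, ← SimpleGraph.card_neighborFinset_eq_degree, card_eq_zero] at this
        intro u hu
        have hm := (G.mem_neighborFinset v u).mpr hu
        rw [this] at hm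
        exact notMem_empty u hm
      simp [SimpleGraph.lapMatrix, SimpleGraph.degMatrix, hr.degree_eq, h0, hv]
    rw [hz, smul_zero]
  · have hpos : (0 : ℝ) < r := by exact_mod_cast h0
    rw [mul_assoc, ← mul_inv, Real.mul_self_sqrt hpos.le, mul_inv_cancel₀ hpos.ne', one_smul]

theorem det_smul_one_add_lapMatrix (G : SimpleGraph V) [DecidableRel G.Adj] {r : ℕ}
    (hr : G.IsRegularOfDegree r) {μ : ℕ → ℝ}
    (hμ : normalizedLaplacianSpectrum G = (Icc 1 (Fintype.card V)).val.map μ) (c : ℝ) :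
    (c • (1 : Matrix V V ℝ) + G.lapMatrix ℝ).det =
      ∏ i ∈ Icc 1 (Fintype.card V), (c + r * μ i) := by
  rw [lapMatrix_eq_smul_normalizedLaplacian G hr]
  by_cases h0 : (r : ℝ) = 0
  · simp [h0]
  · have hc : c • (1 : Matrix V V ℝ) + (r : ℝ) • normalizedLaplacian G =
        (r : ℝ) • ((c / r) • (1 : Matrix V V ℝ) + normalizedLaplacian G) := by
      rw [smul_add, smul_smul, mul_div_cancel₀ _ h0]
    have hcard : (r : ℝ) ^ Fintype.card V = ∏ _i ∈ Icc 1 (Fintype.card V), (r : ℝ) := by simp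
    rw [hc, det_smul, det_smul_one_add_of_charpoly_roots hμ, hcard, ← prod_mul_distrib]
    refine prod_congr rfl fun i _ => ?_
    rw [mul_add, mul_div_cancel₀ _ h0]

/-- Adding the all-ones matrix `J` to `a + L` moves only the eigenvalue `a` of the constant vector,
to `a + |V|`. -/
theorem det_smul_one_add_lapMatrix_add_ones [Nonempty V] (G : SimpleGraph V) [DecidableRel G.Adj]
    {r : ℕ} (hr : G.IsRegularOfDegree r) {ν : ℕ → ℝ}
    (hν : normalizedLaplacianSpectrum G = (Icc 1 (Fintype.card V)).val.map ν) (hν₁ : ν 1 = 0)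
    {a : ℝ} (ha : a ≠ 0) :
    (a • (1 : Matrix V V ℝ) + G.lapMatrix ℝ + vecMulVec 1 1).det =
      (a + Fintype.card V) * ∏ j ∈ Icc 2 (Fintype.card V), (a + r * ν j) := by
  have hfac : a • (1 : Matrix V V ℝ) + G.lapMatrix ℝ + vecMulVec 1 1 =
      (a • (1 : Matrix V V ℝ) + G.lapMatrix ℝ) * (1 + vecMulVec (fun _ => a⁻¹) 1) := by
    have hL : G.lapMatrix ℝ *ᵥ (fun _ => a⁻¹) = 0 := by
      have : (fun _ : V => a⁻¹) = a⁻¹ • fun _ => (1 : ℝ) := by ext; simp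
      rw [this, mulVec_smul, G.lapMatrix_mulVec_const_eq_zero, smul_zero]
    rw [mul_add, mul_one, mul_vecMulVec, add_mulVec, hL, add_zero, smul_mulVec, one_mulVec]
    congr 2
    ext
    simp [ha]
  rw [hfac, det_mul, det_smul_one_add_lapMatrix G hr hν, prod_Icc_one_eq Fintype.card_pos, hν₁,
    vecMulVec_eq Unit, det_one_add_replicateCol_mul_replicateRow]
  simp only [dotProduct, Pi.one_apply, one_mul, sum_const, card_univ, nsmul_eq_mul]
  field_simp
  ring

end Spectrum

/-! ### Block form of the Laplacian of a join and of a subdivision -/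

section Blocks

theorem lapMatrix_apply {V : Type*} [Fintype V] [DecidableEq V] (G : SimpleGraph V)
    [DecidableRel G.Adj] (v w : V) :
    G.lapMatrix ℝ v w =
      (if v = w then ∑ u, if G.Adj v u then (1 : ℝ) else 0 else 0) - if G.Adj v w then 1 else 0 := by
  rw [SimpleGraph.lapMatrix, Matrix.sub_apply, SimpleGraph.degMatrix, diagonal_apply,
    SimpleGraph.adjMatrix_apply, SimpleGraph.degree_eq_sum_if_adj]

/-- The perturbation is supported on the columns of `K`, where it cancels the block of the join
edges from `S` to `K`. -/
theorem lapMatrix_joinAlong_add_vecMulVec {α β : Type*} [Fintype α] [DecidableEq α] [Fintype β]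
    [DecidableEq β] (H : SimpleGraph α) (S : Set α) (K : SimpleGraph β) [DecidableRel H.Adj]
    [DecidableRel K.Adj] [DecidablePred (· ∈ S)] [DecidableRel (joinAlong H S K).Adj] :
    (joinAlong H S K).lapMatrix ℝ +
        vecMulVec (Sum.elim (fun a => if a ∈ S then 1 else 0) 1) (Sum.elim 0 1) =
      fromBlocks
        (H.lapMatrix ℝ + diagonal fun a => if a ∈ S then (Fintype.card β : ℝ) else 0) 0
        (of fun _ a => if a ∈ S then -1 else 0)
        ((∑ a, if a ∈ S then (1 : ℝ) else 0) • (1 : Matrix β β ℝ) + K.lapMatrix ℝ +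
          vecMulVec 1 1) := by
  have h11 : ∀ a a', (joinAlong H S K).Adj (Sum.inl a) (Sum.inl a') ↔ H.Adj a a' :=
    fun _ _ => Iff.rfl
  have h12 : ∀ a b, (joinAlong H S K).Adj (Sum.inl a) (Sum.inr b) ↔ a ∈ S := fun _ _ => Iff.rfl
  have h21 : ∀ a b, (joinAlong H S K).Adj (Sum.inr b) (Sum.inl a) ↔ a ∈ S := fun _ _ => Iff.rfl
  have h22 : ∀ b b', (joinAlong H S K).Adj (Sum.inr b) (Sum.inr b') ↔ K.Adj b b' :=
    fun _ _ => Iff.rfl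
  ext (a | b) (a' | b')
  · rw [Matrix.add_apply, lapMatrix_apply, Fintype.sum_sum_type, fromBlocks_apply₁₁,
      Matrix.add_apply, lapMatrix_apply, diagonal_apply]
    simp only [h11, h12, vecMulVec_apply, Sum.elim_inl, Sum.inl.injEq]
    split_ifs <;> simp
    ring
  · rw [Matrix.add_apply, lapMatrix_apply, fromBlocks_apply₁₂]
    simp [h12, vecMulVec_apply]
  · rw [Matrix.add_apply, lapMatrix_apply, fromBlocks_apply₂₁]
    simp only [h21, vecMulVec_apply]
    split_ifs <;> simp_all
  · rw [Matrix.add_apply, lapMatrix_apply, Fintype.sum_sum_type, fromBlocks_apply₂₂,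
      Matrix.add_apply, Matrix.add_apply, lapMatrix_apply, Matrix.smul_apply, one_apply]
    simp only [h21, h22, vecMulVec_apply, Sum.elim_inr, Sum.inr.injEq]
    split_ifs <;> simp
    ring

/-- The number of spanning trees of `joinAlong H S K` in terms of determinants of the size of `H`
and of `K`. -/
theorem numSpanningTrees_joinAlong {α β : Type*} [Fintype α] [DecidableEq α] [Fintype β]
    [DecidableEq β] [Nonempty β] (H : SimpleGraph α) (S : Set α) (K : SimpleGraph β)
    [DecidableRel H.Adj] [DecidableRel K.Adj] [DecidablePred (· ∈ S)] {s : ℝ}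
    (hs : (∑ a, if a ∈ S then (1 : ℝ) else 0) = s) :
    (s + Fintype.card β) * Fintype.card β * numSpanningTrees (joinAlong H S K) =
      (H.lapMatrix ℝ + diagonal fun a => if a ∈ S then (Fintype.card β : ℝ) else 0).det *
        (s • (1 : Matrix β β ℝ) + K.lapMatrix ℝ + vecMulVec 1 1).det := by
  classical
  have h := det_lapMatrix_add_vecMulVec (joinAlong H S K)
    (Sum.elim (fun a => if a ∈ S then 1 else 0) 1) (Sum.elim 0 1)
  rw [lapMatrix_joinAlong_add_vecMulVec, det_fromBlocks_zero₁₂, Fintype.sum_sum_type,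
    Fintype.sum_sum_type] at h
  simp only [Sum.elim_inl, Sum.elim_inr, hs, Pi.one_apply, Pi.zero_apply, sum_const_zero, zero_add,
    sum_const, card_univ, nsmul_eq_mul, mul_one] at h
  exact h.symm

theorem sum_edgeSet_eq_sum_sym2 {V : Type*} [Fintype V] (G : SimpleGraph V)
    [DecidableRel G.Adj] {f : Sym2 V → ℝ}
    (hf : ∀ e, e ∉ G.edgeSet → f e = 0) : ∑ e : G.edgeSet, f e = ∑ e, f e := by
  rw [← sum_subtype G.edgeFinset (fun _ => G.mem_edgeFinset) f]
  exact sum_subset (subset_univ _) fun e _ he => hf e fun h => he (G.mem_edgeFinset.mpr h)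

variable {V : Type*} [Fintype V] [DecidableEq V]

/-- The vertex-edge incidence matrix, with the columns indexed by the edges only. -/
def edgeIncMatrix (G : SimpleGraph V) : Matrix V G.edgeSet ℝ :=
  of fun v e => if v ∈ (e : Sym2 V) then 1 else 0

theorem edgeIncMatrix_mul_transpose (G : SimpleGraph V) [DecidableRel G.Adj] {r : ℕ}
    (hr : G.IsRegularOfDegree r) :
    edgeIncMatrix G * (edgeIncMatrix G)ᵀ =
      (2 * r : ℝ) • (1 : Matrix V V ℝ) - G.lapMatrix ℝ := by
  have h : edgeIncMatrix G * (edgeIncMatrix G)ᵀ = G.incMatrix ℝ * (G.incMatrix ℝ)ᵀ := by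
    ext v w
    rw [Matrix.mul_apply, Matrix.mul_apply, ← sum_edgeSet_eq_sum_sym2 G]
    · refine sum_congr rfl fun e _ => ?_
      simp [edgeIncMatrix, SimpleGraph.incMatrix_apply', SimpleGraph.incidenceSet]
    · intro e he
      rw [G.incMatrix_of_notMem_incidenceSet fun h => he h.1, zero_mul]
  rw [h, SimpleGraph.incMatrix_mul_transpose]
  ext v w
  rw [Matrix.of_apply, Matrix.sub_apply, Matrix.smul_apply, one_apply, SimpleGraph.lapMatrix,
    Matrix.sub_apply, SimpleGraph.degMatrix, diagonal_apply, SimpleGraph.adjMatrix_apply,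
    hr.degree_eq]
  by_cases hvw : v = w
  · subst hvw; simp; ring
  · simp [hvw]

theorem lapMatrix_subdivision (G : SimpleGraph V) [DecidableRel G.Adj]
    [DecidableRel (subdivision G).Adj] {r : ℕ} (hr : G.IsRegularOfDegree r) :
    (subdivision G).lapMatrix ℝ =
      fromBlocks ((r : ℝ) • 1) (-edgeIncMatrix G) (-(edgeIncMatrix G)ᵀ) ((2 : ℝ) • 1) := by
  have h11 : ∀ v w, ¬ (subdivision G).Adj (Sum.inl v) (Sum.inl w) := fun _ _ h => h
  have h12 : ∀ v e, (subdivision G).Adj (Sum.inl v) (Sum.inr e) ↔ v ∈ (e : Sym2 V) :=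
    fun _ _ => Iff.rfl
  have h21 : ∀ v e, (subdivision G).Adj (Sum.inr e) (Sum.inl v) ↔ v ∈ (e : Sym2 V) :=
    fun _ _ => Iff.rfl
  have h22 : ∀ e f, ¬ (subdivision G).Adj (Sum.inr e) (Sum.inr f) := fun _ _ h => h
  have hdeg : ∀ v, (∑ e : G.edgeSet, if v ∈ (e : Sym2 V) then (1 : ℝ) else 0) = r := by
    intro v
    rw [← hr.degree_eq v, ← G.sum_incMatrix_apply, ← sum_edgeSet_eq_sum_sym2 G]
    · refine sum_congr rfl fun e _ => ?_
      simp [SimpleGraph.incMatrix_apply', SimpleGraph.incidenceSet]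
    · exact fun e he => G.incMatrix_of_notMem_incidenceSet fun h => he h.1
  have hend : ∀ e : G.edgeSet, (∑ v, if v ∈ (e : Sym2 V) then (1 : ℝ) else 0) = 2 := by
    rintro ⟨e, he⟩
    rw [← G.sum_incMatrix_apply_of_mem_edgeSet (R := ℝ) he]
    refine sum_congr rfl fun v _ => ?_
    simp [SimpleGraph.incMatrix_apply', SimpleGraph.incidenceSet, he]
  ext (v | e) (w | f)
  · rw [lapMatrix_apply, Fintype.sum_sum_type, fromBlocks_apply₁₁]
    simp [h11, h12, hdeg, one_apply]
  · rw [lapMatrix_apply, fromBlocks_apply₁₂]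
    simp [h12, edgeIncMatrix]
  · rw [lapMatrix_apply, fromBlocks_apply₂₁]
    simp [h21, edgeIncMatrix]
  · rw [lapMatrix_apply, Fintype.sum_sum_type, fromBlocks_apply₂₂]
    simp [h21, h22, hend, one_apply]

/-- The Schur complement of the scalar block of the edges reduces the determinant to that of a shift of the
Laplacian of `G`. -/
theorem det_fromBlocks_edgeIncMatrix (G : SimpleGraph V) [DecidableRel G.Adj] {r : ℕ}
    (hr : G.IsRegularOfDegree r) (p : ℝ) {q : ℝ} (hq : q ≠ 0) :
    (fromBlocks (p • 1) (-edgeIncMatrix G) (-(edgeIncMatrix G)ᵀ) (q • 1)).det =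
      q ^ ((G.edgeFinset.card : ℤ) - (Fintype.card V : ℤ)) *
        ((p * q - 2 * r) • (1 : Matrix V V ℝ) + G.lapMatrix ℝ).det := by
  let _ : Invertible (q • (1 : Matrix G.edgeSet G.edgeSet ℝ)) :=
    ⟨q⁻¹ • 1, by simp [smul_smul, hq], by simp [smul_smul, hq]⟩
  have hinv : ⅟(q • (1 : Matrix G.edgeSet G.edgeSet ℝ)) = q⁻¹ • 1 := rfl
  have hS : p • (1 : Matrix V V ℝ) - -edgeIncMatrix G * q⁻¹ • (1 : Matrix G.edgeSet G.edgeSet ℝ) *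
      -(edgeIncMatrix G)ᵀ =
      q⁻¹ • ((p * q - 2 * r) • (1 : Matrix V V ℝ) + G.lapMatrix ℝ) := by
    rw [Matrix.mul_smul, Matrix.mul_one, Matrix.smul_mul, Matrix.neg_mul, Matrix.mul_neg,
      neg_neg, edgeIncMatrix_mul_transpose G hr,
      sub_smul, smul_add, smul_sub, smul_sub, smul_smul, smul_smul,
      show q⁻¹ * (p * q) = p by field_simp]
    abel
  rw [det_fromBlocks₂₂, hinv, hS, det_smul, det_smul, det_one, mul_one, ← mul_assoc,
    zpow_sub₀ hq, zpow_natCast, zpow_natCast, inv_pow, div_eq_mul_inv, ← SimpleGraph.edgeFinset_card]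

end Blocks

/-! ### Spanning trees of the two subdivision joins -/

section Joins

variable {V₁ V₂ : Type*} [Fintype V₁] [Fintype V₂] [DecidableEq V₁] [DecidableEq V₂]
  [Nonempty V₁] [Nonempty V₂]

theorem numSpanningTrees_vertexJoin
    (G₁ : SimpleGraph V₁) (G₂ : SimpleGraph V₂) [DecidableRel G₁.Adj] [DecidableRel G₂.Adj]
    {r₁ r₂ : ℕ} (hr₁ : G₁.IsRegularOfDegree r₁) (hr₂ : G₂.IsRegularOfDegree r₂) {μ ν : ℕ → ℝ}
    (hμ : normalizedLaplacianSpectrum G₁ = (Icc 1 (Fintype.card V₁)).val.map μ) (hμ₁ : μ 1 = 0)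
    (hν : normalizedLaplacianSpectrum G₂ = (Icc 1 (Fintype.card V₂)).val.map ν) (hν₁ : ν 1 = 0) :
    (numSpanningTrees (vertexJoin G₁ G₂) : ℝ) =
      2 ^ ((G₁.edgeFinset.card : ℤ) - (Fintype.card V₁ : ℤ) + 1) *
        (∏ i ∈ Icc 2 (Fintype.card V₁), (2 * (Fintype.card V₂ : ℝ) + r₁ * μ i)) *
        ∏ j ∈ Icc 2 (Fintype.card V₂), ((Fintype.card V₁ : ℝ) + r₂ * ν j) := by
  classical
  have hn₁ : (0 : ℝ) < Fintype.card V₁ := by exact_mod_cast Fintype.card_pos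
  have hn₂ : (0 : ℝ) < Fintype.card V₂ := by exact_mod_cast Fintype.card_pos
  have hs : (∑ a : V₁ ⊕ G₁.edgeSet, if a ∈ Set.range Sum.inl then (1 : ℝ) else 0) =
      Fintype.card V₁ := by
    rw [Fintype.sum_sum_type]
    simp
  have hblock : (subdivision G₁).lapMatrix ℝ + (diagonal fun a =>
      if a ∈ Set.range (Sum.inl : V₁ → V₁ ⊕ G₁.edgeSet) then (Fintype.card V₂ : ℝ) else 0) =
      fromBlocks ((r₁ + Fintype.card V₂ : ℝ) • 1) (-edgeIncMatrix G₁) (-(edgeIncMatrix G₁)ᵀ)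
        ((2 : ℝ) • 1) := by
    rw [lapMatrix_subdivision G₁ hr₁]
    ext (v | e) (w | f) <;> simp [diagonal_apply, one_apply]
    split_ifs <;> simp
  have h := numSpanningTrees_joinAlong (subdivision G₁) (Set.range Sum.inl) G₂ hs
  rw [hblock, det_fromBlocks_edgeIncMatrix G₁ hr₁ _ two_ne_zero,
    show (r₁ + Fintype.card V₂ : ℝ) * 2 - 2 * r₁ = 2 * Fintype.card V₂ by ring,
    det_smul_one_add_lapMatrix G₁ hr₁ hμ, prod_Icc_one_eq Fintype.card_pos, hμ₁,
    det_smul_one_add_lapMatrix_add_ones G₂ hr₂ hν hν₁ hn₁.ne'] at h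
  have hpos : ((Fintype.card V₁ : ℝ) + Fintype.card V₂) * Fintype.card V₂ ≠ 0 := by positivity
  refine mul_left_cancel₀ hpos (h.trans ?_)
  rw [zpow_add_one₀ two_ne_zero]
  ring

theorem numSpanningTrees_edgeJoin
    (G₁ : SimpleGraph V₁) (G₂ : SimpleGraph V₂) [DecidableRel G₁.Adj] [DecidableRel G₂.Adj]
    {r₁ r₂ : ℕ} (hr₁ : G₁.IsRegularOfDegree r₁) (hr₂ : G₂.IsRegularOfDegree r₂) {μ ν : ℕ → ℝ}
    (hμ : normalizedLaplacianSpectrum G₁ = (Icc 1 (Fintype.card V₁)).val.map μ) (hμ₁ : μ 1 = 0)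
    (hν : normalizedLaplacianSpectrum G₂ = (Icc 1 (Fintype.card V₂)).val.map ν) (hν₁ : ν 1 = 0) :
    (numSpanningTrees (edgeJoin G₁ G₂) : ℝ) =
      (r₁ : ℝ) ^ Fintype.card V₁ *
        (2 + (Fintype.card V₂ : ℝ)) ^ ((G₁.edgeFinset.card : ℤ) - (Fintype.card V₁ : ℤ)) *
        (∏ i ∈ Icc 2 (Fintype.card V₁), ((Fintype.card V₂ : ℝ) + μ i)) *
        ∏ j ∈ Icc 2 (Fintype.card V₂), ((G₁.edgeFinset.card : ℝ) + r₂ * ν j) := by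
  classical
  have hn₂ : (0 : ℝ) < Fintype.card V₂ := by exact_mod_cast Fintype.card_pos
  have hm₁ : (0 : ℝ) ≤ G₁.edgeFinset.card := Nat.cast_nonneg _
  have hs : (∑ a : V₁ ⊕ G₁.edgeSet, if a ∈ Set.range Sum.inr then (1 : ℝ) else 0) =
      G₁.edgeFinset.card := by
    rw [Fintype.sum_sum_type, SimpleGraph.edgeFinset_card]
    simp
  have hblock : (subdivision G₁).lapMatrix ℝ + (diagonal fun a =>
      if a ∈ Set.range (Sum.inr : G₁.edgeSet → V₁ ⊕ G₁.edgeSet)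
        then (Fintype.card V₂ : ℝ) else 0) =
      fromBlocks ((r₁ : ℝ) • 1) (-edgeIncMatrix G₁) (-(edgeIncMatrix G₁)ᵀ)
        ((2 + Fintype.card V₂ : ℝ) • 1) := by
    rw [lapMatrix_subdivision G₁ hr₁]
    ext (v | e) (w | f) <;> simp [diagonal_apply, one_apply]
    split_ifs <;> simp
  have hprod : ∏ i ∈ Icc 1 (Fintype.card V₁), ((r₁ * Fintype.card V₂ : ℝ) + r₁ * μ i) =
      (r₁ : ℝ) ^ Fintype.card V₁ *
        (Fintype.card V₂ * ∏ i ∈ Icc 2 (Fintype.card V₁), ((Fintype.card V₂ : ℝ) + μ i)) := by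
    have h1 := prod_Icc_one_eq (Fintype.card_pos (α := V₁)) fun i => (Fintype.card V₂ : ℝ) + μ i
    rw [hμ₁, add_zero] at h1
    rw [← h1]
    simp only [← mul_add, prod_mul_distrib, prod_const, Nat.card_Icc, Nat.add_sub_cancel]
  have h := numSpanningTrees_joinAlong (subdivision G₁) (Set.range Sum.inr) G₂ hs
  rw [hblock, det_fromBlocks_edgeIncMatrix G₁ hr₁ _ (by positivity),
    show (r₁ : ℝ) * (2 + Fintype.card V₂) - 2 * r₁ = r₁ * Fintype.card V₂ by ring,
    det_smul_one_add_lapMatrix G₁ hr₁ hμ, hprod] at h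
  have hpos : ((G₁.edgeFinset.card : ℝ) + Fintype.card V₂) * Fintype.card V₂ ≠ 0 := by positivity
  refine mul_left_cancel₀ hpos (h.trans ?_)
  rcases Nat.eq_zero_or_pos r₁ with h0 | h0
  -- If `G₁` has no edges, `|E(G₁)| + L(G₂)` is singular, but both sides have the factor `0 ^ |V₁|`.
  · simp [h0]
  · have hm : (G₁.edgeFinset.card : ℝ) ≠ 0 := by
      have hsum := G₁.sum_degrees_eq_twice_card_edges
      simp only [hr₁.degree_eq, sum_const, card_univ, smul_eq_mul] at hsum
      have := Nat.mul_pos (Fintype.card_pos (α := V₁)) h0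
      exact_mod_cast (by omega : G₁.edgeFinset.card ≠ 0)
    rw [det_smul_one_add_lapMatrix_add_ones G₂ hr₂ hν hν₁ hm]
    ring

end Joins

end SubdivJoin

theorem theorem3p4
    {V₁ V₂ : Type*} [Fintype V₁] [Fintype V₂] [DecidableEq V₁] [DecidableEq V₂]
    [Nonempty V₁] [Nonempty V₂]
    (G₁ : SimpleGraph V₁) (G₂ : SimpleGraph V₂) [DecidableRel G₁.Adj] [DecidableRel G₂.Adj]
    (n₁ m₁ r₁ n₂ r₂ : ℕ)
    (hn₁ : Fintype.card V₁ = n₁) (hm₁ : G₁.edgeFinset.card = m₁)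
    (hr₁ : G₁.IsRegularOfDegree r₁)
    (hn₂ : Fintype.card V₂ = n₂) (hr₂ : G₂.IsRegularOfDegree r₂)
    (μ ν : ℕ → ℝ)
    (hμ : SubdivJoin.normalizedLaplacianSpectrum G₁ = (Finset.Icc 1 n₁).val.map μ)
    (hμ₁ : μ 1 = 0)
    (hν : SubdivJoin.normalizedLaplacianSpectrum G₂ = (Finset.Icc 1 n₂).val.map ν)
    (hν₁ : ν 1 = 0) :
    (SubdivJoin.numSpanningTrees (SubdivJoin.vertexJoin G₁ G₂) : ℝ) =
        (2 : ℝ) ^ ((m₁ : ℤ) - (n₁ : ℤ) + 1) *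
          (∏ i ∈ Finset.Icc 2 n₁, (2 * (n₂ : ℝ) + (r₁ : ℝ) * μ i)) *
          ∏ j ∈ Finset.Icc 2 n₂, ((n₁ : ℝ) + (r₂ : ℝ) * ν j) ∧
    (SubdivJoin.numSpanningTrees (SubdivJoin.edgeJoin G₁ G₂) : ℝ) =
        (r₁ : ℝ) ^ n₁ * (2 + (n₂ : ℝ)) ^ ((m₁ : ℤ) - (n₁ : ℤ)) *
          (∏ i ∈ Finset.Icc 2 n₁, ((n₂ : ℝ) + μ i)) *
          ∏ j ∈ Finset.Icc 2 n₂, ((m₁ : ℝ) + (r₂ : ℝ) * ν j) := by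
  subst hn₁ hm₁ hn₂
  exact ⟨SubdivJoin.numSpanningTrees_vertexJoin G₁ G₂ hr₁ hr₂ hμ hμ₁ hν hν₁,
    SubdivJoin.numSpanningTrees_edgeJoin G₁ G₂ hr₁ hr₂ hμ hμ₁ hν hν₁⟩
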